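/- Let $L$ be a first-order language and let $\mathcal M$ be an $L$-structure with underlying set $M$ such that $|M|$ is an infinite regular cardinal, $\mathcal M$ is $|M|$-saturated, and $\mathcal M$ has quantifier elimination (every formula is equivalent in $\mathcal M$ to a quantifier-free formula). Definitions. The quantifier-free type $\mathrm{qftp}(\mathbf a)$ of a tuple $\mathbf a$ of elements of $M$ is the set of all literals that are true of $\mathbf a$ in $\mathcal M$. - $\mathcal M$ has *strong universal duplication of quantifier-free types* if for every tuple $\mathbf a$ in $M$ of length $<|M|$ and every $c\in M$ not in $\mathbf a$, the set $\{b\in M : \mathrm{qftp}(\mathbf a,b)=\mathrm{qftp}(\mathbf a,c)\}$ is the underlying set of a substructure of $\mathcal M$ that is isomorphic to $\mathcal M$. - $\mathcal M$ has a *unique unary quantifier-free type* if $\mathrm{qftp}(a)=\mathrm{qftp}(b)$ for all $a,b\in M$. - $\mathcal M$ has *3-amalgamation of quantifier-free types* if, whenever $p(\mathbf x,\mathbf y)$, $q(\mathbf y,\mathbf z)$, $r(\mathbf z,\mathbf x)$ are quantifier-free types, $\mathbf x,\mathbf y,\mathbf z$ being finite tuples of variables, each realized in $\mathcal M$ by a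 pair of disjoint tuples, such that $p,r$ have the same restriction to $\mathbf x$, $p,q$ the same restriction to $\mathbf y$, and $q,r$ the same restriction to $\mathbf z$, there is a quantifier-free type in $(\mathbf x,\mathbf y,\mathbf z)$ realized in $\mathcal M$ whose restrictions to $\mathbf x\mathbf y$, $\mathbf y\mathbf z$, $\mathbf z\mathbf x$ are $p,q,r$. - If $L$ is relational, the *age* of $\mathcal M$ is the class of finite structures that embed in $\mathcal M$. It has the *3-disjoint amalgamation property* if for all $\mathcal A_0,\mathcal A_1,\mathcal A_2$ in the age such that $\mathcal A_i$ and $\mathcal A_j$ induce the same structure on $A_i\cap A_j$ for all $i,j$, there is a $\mathcal B$ in the age with $A_i\subseteq B$ and $\mathcal B{\restriction}A_i=\mathcal A_i$ for all $i$. - A set $Y$ of finite sets is a *sunflower* if there is a set $r$ with $p\cap q=r$ for all distinct $p,q\in Y$. $\mathcal M$ is *sunflowerable* if for every $n\in\mathbb N$ and every $L$-structure $\mathcal Y\cong\mathcal M$ whose elements are sets of size $n$ there is a substructure $\mathcal Z\subseteq\mathcal Y$ with $\mathcal Z\cong\mathcal Y$ whose underlying set is a sunflower. Then: 1. If $\mathcal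 M$ has strong universal duplication of quantifier-free types, then $\mathcal M$ is sunflowerable. 2. If $\mathcal M$ has a unique unary quantifier-free type and 3-amalgamation of quantifier-free types, then $\mathcal M$ has strong universal duplication of quantifier-free types, and $\mathcal M$ is sunflowerable. 3. If $L$ is relational, $\mathcal M$ has a unique unary quantifier-free type, and the age of $\mathcal M$ has the 3-disjoint amalgamation property, then $\mathcal M$ is sunflowerable. -/

import Mathlib

open FirstOrder Set Cardinal

universe u v w x

namespace StructuredSunflower

section Sunflowers

variable (L : FirstOrder.Language.{u, v})

/-- A family of finite sets is a sunflower if all intersections of two distinct members agree. -/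
def IsSunflower {α : Type x} (Y : Set (Finset α)) : Prop :=
  ∃ r : Set α, ∀ p ∈ Y, ∀ q ∈ Y, p ≠ q → (p : Set α) ∩ (q : Set α) = r

/-- A structure `Y` whose elements are finite sets contains a structured sunflower: a substructure
that is isomorphic to `Y` and whose underlying family of finite sets is a sunflower. -/
def ContainsStructuredSunflower {α : Type x} (Y : Set (Finset α)) [L.Structure Y] : Prop :=
  ∃ Z : L.Substructure Y, Nonempty (Z ≃[L] Y) ∧
    IsSunflower ((fun y : Y => (y : Finset α)) '' (Z : Set Y))

/-- Every isomorphic copy of `M` whose elements are sets of size `n` contains a structured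
sunflower. The type `α` contains the elements of those sets. -/
def NSunflowerable (M : Type w) [L.Structure M] (n : ℕ) : Prop :=
  ∀ (α : Type x) (Y : Set (Finset α)) [L.Structure Y],
    Nonempty (Y ≃[L] M) → (∀ y ∈ Y, y.card = n) → ContainsStructuredSunflower L Y

/-- `M` is sunflowerable if it is `n`-sunflowerable for every `n`. -/
def Sunflowerable (M : Type w) [L.Structure M] : Prop :=
  ∀ n : ℕ, NSunflowerable.{u, v, w, x} L M n

end Sunflowers

section QuantifierFreeTypes

variable (L : FirstOrder.Language.{u, v})

/-- A literal is an atomic formula or the negation of one. -/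
def IsLiteral {L : FirstOrder.Language.{u, v}} {ι : Type x} (φ : L.Formula ι) : Prop :=
  φ.IsAtomic ∨ ∃ ψ : L.Formula ι, ψ.IsAtomic ∧ φ = ψ.not

/-- The complete quantifier-free type of a tuple: the set of literals that are true of it. -/
def qfType {M : Type w} [L.Structure M] {ι : Type x} (a : ι → M) : Set (L.Formula ι) :=
  {φ | IsLiteral φ ∧ φ.Realize a}

variable (M : Type w) [L.Structure M]

/-- All elements of `M` have the same quantifier-free type. -/
def UniqueUnaryQFType : Prop :=
  ∀ a b : M, qfType L (fun _ : Unit => a) = qfType L (fun _ : Unit => b)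

/-- The set of all `b` such that the tuples `(a, c)` and `(a, b)` have the same
quantifier-free type. -/
def duplicates {M : Type w} [L.Structure M] {ι : Type w} (a : ι → M) (c : M) : Set M :=
  {b | qfType L (Sum.elim a (fun _ : Unit => c)) = qfType L (Sum.elim a (fun _ : Unit => b))}

/-- Strong universal duplication of `κ`-quantifier-free types: for every tuple `a` of length less
than `κ` and every `c` not in `a`, the set of duplicates of `c` over `a` is the underlying set of a
substructure of `M`, and this substructure is isomorphic to `M`. -/
def StrongUniversalDuplicationBelow (κ : Cardinal.{w}) : Prop :=
  ∀ (ι : Type w) (a : ι → M), #ι < κ → ∀ c : M, c ∉ range a →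
    ∃ S : L.Substructure M, (S : Set M) = duplicates L a c ∧ Nonempty (S ≃[L] M)

/-- Strong universal duplication of quantifier-free types: the case `κ = |M|`. -/
def StrongUniversalDuplication : Prop :=
  StrongUniversalDuplicationBelow L M #M

/-- `3`-amalgamation of quantifier-free types: types `p(x, y)`, `q(y, z)`, `r(z, x)` that are
realized in `M` by pairs of disjoint tuples (here `p` by `(a, b)`, `q` by `(b', c)` and `r` by
`(c', a')`) and that have equal restrictions to each of `x`, `y`, `z` have a common extension to a
type in `(x, y, z)` that is realized in `M`. -/
def ThreeAmalgamation : Prop :=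
  ∀ (k l m : ℕ) (a a' : Fin k → M) (b b' : Fin l → M) (c c' : Fin m → M),
    Disjoint (range a) (range b) → Disjoint (range b') (range c) →
    Disjoint (range c') (range a') →
    qfType L a = qfType L a' → qfType L b = qfType L b' → qfType L c = qfType L c' →
    ∃ (x : Fin k → M) (y : Fin l → M) (z : Fin m → M),
      qfType L (Sum.elim x y) = qfType L (Sum.elim a b) ∧
      qfType L (Sum.elim y z) = qfType L (Sum.elim b' c) ∧
      qfType L (Sum.elim z x) = qfType L (Sum.elim c' a')

end QuantifierFreeTypes

section Saturation

variable (L : FirstOrder.Language.{u, v}) (M : Type w) [L.Structure M]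

/-- `M` is `κ`-saturated: every set of formulas in one variable with parameters from a set `A` of
size less than `κ` that is finitely satisfiable in `M` is realized in `M`. A formula over `A` is
given by a formula whose variables are the elements of `A`, which stand for themselves, and one
further variable. -/
def IsSaturated (κ : Cardinal.{w}) : Prop :=
  ∀ A : Set M, #A < κ → ∀ p : Set (L.Formula (A ⊕ Unit)),
    (∀ F : Set (L.Formula (A ⊕ Unit)), F ⊆ p → F.Finite →
      ∃ b : M, ∀ φ ∈ F, φ.Realize (Sum.elim (fun t : A => (t : M)) (fun _ => b))) →
    ∃ b : M, ∀ φ ∈ p, φ.Realize (Sum.elim (fun t : A => (t : M)) (fun _ => b))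

/-- `M` has quantifier elimination: every formula is equivalent in `M` to a quantifier-free
formula in the same variables. -/
def HasQuantifierElimination : Prop :=
  ∀ (n : ℕ) (φ : L.Formula (Fin n)), ∃ ψ : L.Formula (Fin n),
    ψ.IsQF ∧ ∀ a : Fin n → M, φ.Realize a ↔ ψ.Realize a

end Saturation

section Ages

open CategoryTheory

/-- The `n`-disjoint amalgamation property of a class of structures in a relational language:
members `A 0, …, A (n - 1)` that agree on the intersections of their underlying sets embed in one
member of the class, so that points of `A i` and `A j` have the same image only if they are
equal (and always if they are equal). -/
def DisjointAmalgamationProperty (L : FirstOrder.Language.{u, v}) [L.IsRelational] (n : ℕ)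
    (K : Set (Bundled.{w} L.Structure)) : Prop :=
  ∀ (X : Type w) (A : Fin n → Set X) (S : ∀ i, L.Structure (A i)),
    (∀ i, (⟨A i, S i⟩ : Bundled.{w} L.Structure) ∈ K) →
    (∀ (i j : Fin n) (k : ℕ) (R : L.Relations k) (t : Fin k → X)
      (hi : ∀ s, t s ∈ A i) (hj : ∀ s, t s ∈ A j),
      (S i).RelMap R (fun s => ⟨t s, hi s⟩) ↔ (S j).RelMap R (fun s => ⟨t s, hj s⟩)) →
    ∃ B ∈ K, ∃ f : ∀ i, A i ↪[L] B,
      ∀ (i j : Fin n) (a : A i) (b : A j), f i a = f j b ↔ (a : X) = (b : X)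

end Ages

end StructuredSunflower

/-! Quantifier elimination turns quantifier-free types into complete types. Partial elementary maps
are handled as sets of pairs; being one is a property of finite character, so each copy of `M` is
built greedily by `exists_meets_of_finite_character`, with saturation supplying the next point.

The heart of part 1 is indivisibility, `exists_containsCopy_of_cover`. Let fewer than `|M|` sets `X
i` cover `M`. If `X i` contains no copy of `M`, then each type of a point `c` over a small set `A`
with `c ∉ A` extends to another such type that is not realized in `X i`: otherwise a copy of `M`
could be built inside `X i`, by moving the set of duplicates of `c` over `A`, itself a copy of `M`.
If this held for all `i`, a chain of such extensions would have a common realization, lying in no `X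
i`.

Sunflowers follow by induction on `n`. If one element `e` lies in all the labels of some copy, pass
to that copy and erase `e`. Otherwise a copy with pairwise disjoint labels is built greedily: the
possible next points form a copy of `M`, and if all their labels met earlier labels, the fewer than
`|M|` elements used so far would induce a cover, so one of them would lie in all the labels of a
copy.

For part 2, 3-amalgamation and the unique unary type give a common realization of types over
disjoint small sets, and back-and-forth then identifies `M` with the set of duplicates. For part 3,
disjoint amalgamation of three finite structures yields 3-amalgamation of types. -/

namespace StructuredSunflower

/-! ### Greedy transfinite constructions -/

/-- A property of finite character holds for the image of a set if it holds for the images of all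
its initial segments. -/
theorem of_forall_image_Iic {T I : Type w} [LinearOrder I] {Φ : Set T → Prop}
    (hmono : ∀ R R', R' ⊆ R → Φ R → Φ R')
    (hfin : ∀ R, (∀ F ⊆ R, F.Finite → Φ F) → Φ R) (hempty : Φ ∅) (t : I → T) (s : Set I)
    (h : ∀ i ∈ s, Φ (t '' Iic i)) : Φ (t '' s) := by
  classical
  refine hfin _ fun F hF hFf => ?_
  lift F to Finset T using hFf
  obtain ⟨G, hG, rfl⟩ := Finset.subset_set_image_iff.1 hF
  rcases G.eq_empty_or_nonempty with rfl | hG'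
  · simpa using hempty
  · refine hmono _ _ ?_ (h _ (hG (G.max'_mem hG')))
    rw [Finset.coe_image]
    exact image_mono fun j hj => G.le_max' j hj

/-- Greedy transfinite construction: a property of finite character that can always be kept while
adding a point of any prescribed set holds for some set that meets all the prescribed sets. -/
theorem exists_meets_of_finite_character {T I : Type w} {κ : Cardinal.{w}} (hI : #I ≤ κ)
    (Φ : Set T → Prop) (D : I → Set T)
    (hmono : ∀ R R', R' ⊆ R → Φ R → Φ R')
    (hfin : ∀ R, (∀ F ⊆ R, F.Finite → Φ F) → Φ R) (hempty : Φ ∅)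
    (step : ∀ R : Set T, #R < κ → Φ R → ∀ i, ∃ s ∈ D i, Φ (insert s R)) :
    ∃ t : I → T, Φ (range t) ∧ ∀ i, t i ∈ D i := by
  classical
  -- A well-order of least possible type, so that every proper initial segment has size below `κ`.
  obtain ⟨_, _, ho⟩ := exists_ord_eq_type_lt I
  have hsmall : ∀ i : I, #(Iio i) < κ := fun i => (mk_Iio_lt i ho).trans_le hI
  rcases isEmpty_or_nonempty I with hI' | ⟨⟨i₀⟩⟩
  · exact ⟨fun i => isEmptyElim i, by rwa [range_eq_empty], fun i => isEmptyElim i⟩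
  -- A junk value for the recursion when no good choice exists; `key` shows that this case never
  -- occurs.
  let t₀ : T := (step ∅ (by simpa using pos_of_gt (hsmall i₀)) hempty i₀).choose
  let t : I → T := WellFoundedLT.fix (motive := fun _ => T) fun i f =>
    if h : ∃ s ∈ D i, Φ (insert s (range fun j : Iio i => f j.1 j.2)) then h.choose else t₀
  have ht : ∀ i, Φ (t '' Iio i) → t i ∈ D i ∧ Φ (t '' Iic i) := by
    intro i hi
    rw [← Iio_insert, image_insert_eq]
    rw [image_eq_range] at hi ⊢
    have h := step _ (mk_range_le.trans_lt (hsmall i)) hi i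
    have e : t i = h.choose := by
      simp only [t]
      rw [WellFoundedLT.fix_eq]
      exact dif_pos h
    rw [e]
    exact h.choose_spec
  have key : ∀ i, Φ (t '' Iio i) := by
    intro i
    induction i using WellFoundedLT.induction with
    | ind i ih => exact of_forall_image_Iic hmono hfin hempty t _ fun j hj => (ht j (ih j hj)).2
  refine ⟨t, ?_, fun i => (ht i (key i)).1⟩
  rw [← image_univ]
  exact of_forall_image_Iic hmono hfin hempty t _ fun j _ => (ht j (key j)).2

/-! ### Complete types and partial elementary maps as sets of pairs -/

section Types

variable (L : FirstOrder.Language.{u, v}) {M : Type w} [L.Structure M]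

/-- Two tuples have the same complete type. -/
def SameType {ι : Type x} (a b : ι → M) : Prop :=
  ∀ φ : L.Formula ι, φ.Realize a ↔ φ.Realize b

/-- A set of pairs is partial elementary if its two coordinate tuples have the same type. -/
def PartialElementary (R : Set (M × M)) : Prop :=
  SameType L (fun t : R => t.1.1) (fun t : R => t.1.2)

/-- The diagonal of a set, as a set of pairs. -/
def diag (A : Set M) : Set (M × M) := (fun a => (a, a)) '' A

/-- `c` and `d` have the same type over `A`. -/
def SameTypeOver (A : Set M) (c d : M) : Prop := PartialElementary L (insert (c, d) (diag A))

variable {L}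

theorem SameType.comp {ι : Type*} {ι' : Type*} {a b : ι → M} (h : SameType L a b) (s : ι' → ι) :
    SameType L (a ∘ s) (b ∘ s) := fun φ => by
  simpa only [Language.Formula.realize_relabel] using h (φ.relabel s)

theorem sameType_of_imp {ι : Type*} {a b : ι → M}
    (h : ∀ φ : L.Formula ι, φ.Realize a → φ.Realize b) : SameType L a b := fun φ =>
  ⟨h φ, fun hb => by_contra fun ha => h φ.not ha hb⟩

theorem SameType.symm {ι : Type*} {a b : ι → M} (h : SameType L a b) : SameType L b a :=
  fun φ => (h φ).symm

/-- A formula has only finitely many free variables. This gives finite character, and reduces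
arbitrary tuples to the finite ones for which quantifier elimination is stated. -/
theorem sameType_iff_forall_fin {ι : Type*} {a b : ι → M} :
    SameType L a b ↔ ∀ (n : ℕ) (s : Fin n → ι), SameType L (a ∘ s) (b ∘ s) := by
  classical
  refine ⟨fun h n s => h.comp s, fun h φ => ?_⟩
  let e := φ.freeVarFinset.equivFin
  have key : ∀ v : ι → M,
      Language.Formula.Realize (φ.restrictFreeVar e : L.Formula (Fin _))
        (v ∘ fun i => (e.symm i : ι)) ↔ φ.Realize v := fun v =>
    Language.BoundedFormula.realize_restrictFreeVar v (by simp)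
  rw [← key a, ← key b]
  exact h _ _ _

theorem PartialElementary.sameType {R : Set (M × M)} (h : PartialElementary L R) {ι : Type*}
    {a b : ι → M} (hR : ∀ i, (a i, b i) ∈ R) : SameType L a b :=
  SameType.comp h fun i => ⟨_, hR i⟩

theorem SameType.partialElementary {ι : Type*} {a b : ι → M} (h : SameType L a b)
    {R : Set (M × M)} (hR : ∀ t ∈ R, ∃ i, (a i, b i) = t) : PartialElementary L R := by
  choose s hs using fun t : R => hR t t.2
  have := h.comp s
  rwa [show a ∘ s = fun t : R => t.1.1 from funext fun t => congrArg Prod.fst (hs t),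
    show b ∘ s = fun t : R => t.1.2 from funext fun t => congrArg Prod.snd (hs t)] at this

theorem PartialElementary.mono {R R' : Set (M × M)} (h : PartialElementary L R) (hR : R' ⊆ R) :
    PartialElementary L R' :=
  h.sameType fun t => hR t.2

theorem partialElementary_of_finite {R : Set (M × M)}
    (h : ∀ F ⊆ R, F.Finite → PartialElementary L F) : PartialElementary L R :=
  sameType_iff_forall_fin.2 fun _ s =>
    (h (range fun i => (s i).1) (by rintro _ ⟨i, rfl⟩; exact (s i).2) (finite_range _)).sameType
      fun i => ⟨i, rfl⟩

theorem PartialElementary.trans {R S Q : Set (M × M)} (hR : PartialElementary L R)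
    (hS : PartialElementary L S) (hQ : ∀ t ∈ Q, ∃ y, (t.1, y) ∈ R ∧ (y, t.2) ∈ S) :
    PartialElementary L Q := by
  choose y hy using fun t : Q => hQ t t.2
  exact fun φ => (hR.sameType (fun t => (hy t).1) φ).trans (hS.sameType (fun t => (hy t).2) φ)

theorem PartialElementary.swap {R : Set (M × M)} (h : PartialElementary L R) :
    PartialElementary L (Prod.swap '' R) := fun φ =>
  (h.sameType (a := fun t : Prod.swap '' R => t.1.2) (b := fun t => t.1.1) (by
    rintro ⟨_, t, ht, rfl⟩; exact ht) φ).symm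

theorem SameType.eq_iff {ι : Type*} {a b : ι → M} (h : SameType L a b) (i j : ι) :
    a i = a j ↔ b i = b j := by
  simpa [Language.Formula.realize_equal] using
    h (Language.Term.equal (Language.Term.var i) (Language.Term.var j))

theorem PartialElementary.eq_iff {R : Set (M × M)} (h : PartialElementary L R) {s t : M × M}
    (hs : s ∈ R) (ht : t ∈ R) : s.1 = t.1 ↔ s.2 = t.2 :=
  SameType.eq_iff h ⟨s, hs⟩ ⟨t, ht⟩

theorem partialElementary_diag (A : Set M) : PartialElementary L (diag A) :=
  SameType.partialElementary (a := fun a : A => (a : M)) (b := fun a => (a : M)) (fun _ => Iff.rfl)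
    (by rintro _ ⟨a, ha, rfl⟩; exact ⟨⟨a, ha⟩, rfl⟩)

theorem partialElementary_empty : PartialElementary L (∅ : Set (M × M)) := by
  have := partialElementary_diag (L := L) (∅ : Set M)
  rwa [diag, image_empty] at this

theorem SameTypeOver.mono {A B : Set M} {c d : M} (h : SameTypeOver L B c d) (hA : A ⊆ B) :
    SameTypeOver L A c d :=
  PartialElementary.mono h (insert_subset_insert (image_mono hA))

theorem SameTypeOver.refl (A : Set M) (c : M) : SameTypeOver L A c c := by
  have := partialElementary_diag (L := L) (insert c A)
  rwa [diag, image_insert_eq] at this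

/-- The image `d` supplied by saturation may be exchanged for any point of the same type over the
previous images; this freedom drives the greedy constructions. -/
theorem PartialElementary.insert_trans {R : Set (M × M)} {A : Set M} {m d b : M}
    (h : PartialElementary L (insert (m, d) R)) (hR : Prod.snd '' R ⊆ A)
    (hb : SameTypeOver L A d b) : PartialElementary L (insert (m, b) R) := by
  refine h.trans hb ?_
  rintro t (rfl | ht)
  · exact ⟨d, Or.inl rfl, Or.inl rfl⟩
  · exact ⟨t.2, Or.inr ht, Or.inr ⟨t.2, hR ⟨t, ht, rfl⟩, rfl⟩⟩

theorem SameTypeOver.trans {A : Set M} {c d e : M} (h : SameTypeOver L A c d)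
    (h' : SameTypeOver L A d e) : SameTypeOver L A c e :=
  PartialElementary.insert_trans h (by rintro _ ⟨_, ⟨a, ha, rfl⟩, rfl⟩; exact ha) h'

theorem SameTypeOver.notMem {A : Set M} {c d : M} (h : SameTypeOver L A c d) (hc : c ∉ A) :
    d ∉ A := fun hd => hc <| by
  have : c = d := (PartialElementary.eq_iff h (Or.inl rfl) (Or.inr ⟨d, hd, rfl⟩)).2 rfl
  rwa [this]

end Types

/-! ### Quantifier-free types, embeddings and duplicates -/

section QuantifierElimination

variable {L : FirstOrder.Language.{u, v}} {M : Type w} [L.Structure M]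

theorem qfType_eq_iff_forall_isAtomic {N : Type*} [L.Structure N] {ι : Type*} {a : ι → M}
    {b : ι → N} : qfType L a = qfType L b ↔
      ∀ φ : L.Formula ι, φ.IsAtomic → (φ.Realize a ↔ φ.Realize b) := by
  refine ⟨fun h φ hφ => ?_, fun h => ?_⟩
  · have := Set.ext_iff.1 h φ
    simpa [qfType, IsLiteral, hφ] using this
  · ext φ
    refine and_congr_right ?_
    rintro (hφ | ⟨ψ, hψ, rfl⟩)
    · exact h φ hφ
    · exact not_congr (h ψ hψ)

theorem SameType.qfType_eq {ι : Type*} {a b : ι → M} (h : SameType L a b) :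
    qfType L a = qfType L b :=
  Set.ext fun φ => and_congr_right fun _ => h φ

theorem HasQuantifierElimination.qfType_eq_iff (hqe : HasQuantifierElimination L M) {ι : Type*}
    {a b : ι → M} : qfType L a = qfType L b ↔ SameType L a b := by
  refine ⟨fun h => sameType_iff_forall_fin.2 fun n s φ => ?_, SameType.qfType_eq⟩
  rw [qfType_eq_iff_forall_isAtomic] at h
  obtain ⟨ψ, hψ, hφψ⟩ := hqe n φ
  rw [hφψ, hφψ]
  have key : ∀ χ : L.Formula (Fin n), χ.IsAtomic → (χ.Realize (a ∘ s) ↔ χ.Realize (b ∘ s)) :=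
    fun χ hχ => by
      rw [← Language.Formula.realize_relabel, ← Language.Formula.realize_relabel]
      exact h _ (hχ.relabel _)
  clear hφψ
  induction hψ with
  | falsum => exact Iff.rfl
  | of_isAtomic hχ => exact key _ hχ
  | imp _ _ h₁ h₂ => exact imp_congr h₁ h₂

theorem qfType_embedding_comp {N : Type*} [L.Structure N] (g : N ↪[L] M) {ι : Type*} (a : ι → N) :
    qfType L (g ∘ a) = qfType L a := by
  rw [qfType_eq_iff_forall_isAtomic]
  intro φ hφ
  -- The empty tuple of bound variables is rewritten as an image under `g`, so that the whole
  -- assignment factors through `g`.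
  rw [Language.Formula.Realize, Language.Formula.Realize,
    ← Subsingleton.elim (g ∘ (default : Fin 0 → N)) default]
  cases hφ with
  | equal t₁ t₂ =>
    simp only [Language.BoundedFormula.realize_bdEqual, ← Sum.comp_elim,
      Language.HomClass.realize_term, g.injective.eq_iff]
  | rel R ts =>
    simp only [Language.BoundedFormula.realize_rel, ← Sum.comp_elim,
      Language.HomClass.realize_term]
    exact Language.StrongHomClass.map_rel g R fun i => (ts i).realize _

theorem HasQuantifierElimination.partialElementary_graph (hqe : HasQuantifierElimination L M)
    (g : M ↪[L] M) : PartialElementary L (range fun m => (m, g m)) :=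
  (hqe.qfType_eq_iff.1 (qfType_embedding_comp g id).symm).partialElementary fun _ => id

/-- A total partial elementary set of pairs is the graph of an embedding. -/
noncomputable def PartialElementary.embedding {R : Set (M × M)} (h : PartialElementary L R)
    (g : M → M) (hg : ∀ m, (m, g m) ∈ R) : M ↪[L] M where
  toFun := g
  inj' a b hab := (h.eq_iff (hg a) (hg b)).2 hab
  map_fun' {n} f v := by
    have := h.sameType (a := Fin.cases (Language.Structure.funMap f v) v)
      (b := Fin.cases (g (Language.Structure.funMap f v)) (g ∘ v))
      (Fin.cases (hg _) fun i => hg _)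
      (Language.Term.equal (Language.Term.var 0)
        (Language.Term.func f fun i => Language.Term.var i.succ))
    simpa [Language.Formula.realize_equal, Function.comp_def] using this
  map_rel' {n} r v := by
    have := h.sameType (a := v) (b := g ∘ v) (fun i => hg _)
      (Language.Relations.formula r fun i => Language.Term.var i)
    simpa [Language.Formula.realize_rel, Function.comp_def] using this.symm

theorem HasQuantifierElimination.duplicates_eq (hqe : HasQuantifierElimination L M) {ι : Type w}
    (a : ι → M) (c : M) : duplicates L a c = {b | SameTypeOver L (range a) c b} := by
  ext b
  rw [duplicates, mem_ofPred_eq, hqe.qfType_eq_iff]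
  constructor
  · intro h
    refine h.partialElementary ?_
    rintro _ (rfl | ⟨_, ⟨i, rfl⟩, rfl⟩)
    · exact ⟨Sum.inr (), rfl⟩
    · exact ⟨Sum.inl i, rfl⟩
  · intro h
    refine PartialElementary.sameType h ?_
    rintro (i | i)
    · exact Or.inr ⟨_, ⟨i, rfl⟩, rfl⟩
    · exact Or.inl rfl

end QuantifierElimination

/-! ### Extending partial elementary maps by saturation -/

section Saturation

variable {L : FirstOrder.Language.{u, v}} {M : Type w} [L.Structure M] {κ : Cardinal.{w}}

/-- Saturation, for types transported along partial elementary sets of pairs: if finite parts of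
the types of `c j` over the domains of `R j` have a common realization over the images, then so have
the whole types. -/
theorem IsSaturated.exists_forall_of_formulas (hsat : IsSaturated L M κ) {J : Type*}
    (R : J → Set (M × M)) (c : J → M) (hR : #(⋃ j, Prod.snd '' R j) < κ)
    (h : ∀ F : Set (Σ j, L.Formula (R j ⊕ Unit)), F.Finite →
      (∀ x ∈ F, x.2.Realize (Sum.elim (fun t => t.1.1) (fun _ => c x.1))) →
      ∃ d, ∀ x ∈ F, x.2.Realize (Sum.elim (fun t => t.1.2) (fun _ => d))) :
    ∃ d, ∀ j, PartialElementary L (insert (c j, d) (R j)) := by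
  let val : ∀ j, R j → ⋃ j, Prod.snd '' R j := fun j t =>
    ⟨t.1.2, mem_iUnion.2 ⟨j, t, t.2, rfl⟩⟩
  let T : (Σ j, L.Formula (R j ⊕ Unit)) → L.Formula ((⋃ j, Prod.snd '' R j : Set M) ⊕ Unit) :=
    fun x => x.2.relabel (Sum.map (val x.1) id)
  have hT : ∀ x d, (T x).Realize (Sum.elim (fun t => (t : M)) (fun _ => d)) ↔
      x.2.Realize (Sum.elim (fun t => t.1.2) (fun _ => d)) := fun x d => by
    simp only [T, Language.Formula.realize_relabel, Sum.elim_comp_map]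
    rfl
  obtain ⟨d, hd⟩ := hsat _ hR
    (T '' {x | x.2.Realize (Sum.elim (fun t => t.1.1) (fun _ => c x.1))}) (by
      intro F hF hFf
      classical
      lift F to Finset (L.Formula ((⋃ j, Prod.snd '' R j : Set M) ⊕ Unit)) using hFf
      obtain ⟨G, hG, rfl⟩ := Finset.subset_set_image_iff.1 hF
      rw [Finset.coe_image]
      obtain ⟨d, hd⟩ := h G G.finite_toSet hG
      exact ⟨d, forall_mem_image.2 fun x hx => (hT x d).2 (hd x hx)⟩)
  refine ⟨d, fun j => ?_⟩
  have : SameType L (Sum.elim (fun t : R j => t.1.1) (fun _ : Unit => c j))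
      (Sum.elim (fun t : R j => t.1.2) (fun _ : Unit => d)) :=
    sameType_of_imp fun φ hφ => (hT ⟨j, φ⟩ d).1 (hd _ ⟨⟨j, φ⟩, hφ, rfl⟩)
  refine this.partialElementary ?_
  rintro t (rfl | ht)
  · exact ⟨Sum.inr (), rfl⟩
  · exact ⟨Sum.inl ⟨t, ht⟩, rfl⟩

theorem IsSaturated.exists_insert (hsat : IsSaturated L M κ) {R : Set (M × M)}
    (hR : PartialElementary L R) (hcard : #R < κ) (c : M) :
    ∃ d, PartialElementary L (insert (c, d) R) := by
  obtain ⟨d, hd⟩ := hsat.exists_forall_of_formulas (J := Unit) (fun _ => R) (fun _ => c)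
    (by rw [iUnion_const]; exact mk_image_le.trans_lt hcard) (by
      intro F hF hFc
      have : Finite F := hF
      -- Quantifying out the new variable leaves a formula about the points of `R` alone, which
      -- transfers along `R`.
      have key := hR (Language.Formula.iExs Unit (Language.Formula.iInf fun x : F => x.1.2))
      simp only [Language.Formula.realize_iExs, Language.Formula.realize_iInf] at key
      obtain ⟨d, hd⟩ := key.1 ⟨fun _ => c, fun x => hFc x x.2⟩
      exact ⟨d (), fun x hx => hd ⟨x, hx⟩⟩)
  exact ⟨d, hd ()⟩

/-- Finitely many formulas mention only finitely many indices `j`. This serves both to bound chains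
of types and to glue finite restrictions of two types. -/
theorem IsSaturated.exists_forall (hsat : IsSaturated L M κ) {J : Type*}
    (R : J → Set (M × M)) (c : J → M) (hR : #(⋃ j, Prod.snd '' R j) < κ)
    (h : ∀ s : Set J, s.Finite → ∃ d, ∀ j ∈ s, PartialElementary L (insert (c j, d) (R j))) :
    ∃ d, ∀ j, PartialElementary L (insert (c j, d) (R j)) := by
  refine hsat.exists_forall_of_formulas R c hR fun F hF hFc => ?_
  obtain ⟨d, hd⟩ := h _ (hF.image Sigma.fst)
  refine ⟨d, fun x hx => ((hd x.1 ⟨x, hx, rfl⟩).sameType ?_ x.2).1 (hFc x hx)⟩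
  rintro (t | t)
  · exact Or.inr t.2
  · exact Or.inl rfl

end Saturation

/-! ### Indivisibility from strong universal duplication -/

section Duplication

variable {L : FirstOrder.Language.{u, v}} {M : Type w} [L.Structure M]

/-- `X` contains the underlying set of a copy of `M`. -/
def ContainsCopy (L : FirstOrder.Language.{u, v}) {M : Type w} [L.Structure M] (X : Set M) :
    Prop := ∃ g : M ↪[L] M, ∀ m, g m ∈ X

theorem strongUniversalDuplication_iff (hqe : HasQuantifierElimination L M) :
    StrongUniversalDuplication L M ↔ ∀ (A : Set M) (c : M), #A < #M → c ∉ A →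
      ∃ h : M ↪[L] M, range h = {b | SameTypeOver L A c b} := by
  constructor
  · intro H A c hA hc
    obtain ⟨S, hS, ⟨e⟩⟩ := H A (Subtype.val) hA c (by simpa using hc)
    rw [hqe.duplicates_eq, Subtype.range_coe] at hS
    refine ⟨S.subtype.comp e.symm.toEmbedding, ?_⟩
    rw [← hS]
    ext x
    constructor
    · rintro ⟨y, rfl⟩
      exact (e.symm y).2
    · exact fun hx => ⟨e ⟨x, hx⟩, by simp⟩
  · intro H ι a hι c hc
    obtain ⟨h, hh⟩ := H (range a) c (mk_range_le.trans_lt hι) hc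
    refine ⟨h.toHom.range, ?_, ⟨h.equivRange.symm⟩⟩
    rw [hqe.duplicates_eq, ← hh]
    ext
    simp

/-- If every type over a small set that extends the type of `c` over `A` is realized in `X`, then
`X` contains a copy of `M`. -/
theorem containsCopy_of_forall_exists (hqe : HasQuantifierElimination L M)
    (hsat : IsSaturated L M #M) (hinf : ℵ₀ ≤ #M) {A : Set M} (hA : #A < #M) {c : M} (hc : c ∉ A)
    {h : M ↪[L] M} (hh : range h = {b | SameTypeOver L A c b}) {X : Set M}
    (hX : ∀ (B : Set M) (d : M), #B < #M → d ∉ B → A ⊆ B → SameTypeOver L A c d →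
      ∃ b ∈ X, SameTypeOver L B d b) : ContainsCopy L X := by
  have hh' : ∀ m, SameTypeOver L A c (h m) := fun m => hh.subset ⟨m, rfl⟩
  -- The map into `X` starts from the copy `range h` and fixes `A` pointwise. Hence the type to be
  -- realized at each step extends that of `c` over `A`, as `hX` demands; composing with `h` gives
  -- the copy of `M`.
  obtain ⟨t, ⟨ht, htX⟩, htD⟩ := exists_meets_of_finite_character (T := M × M) (I := M) le_rfl
    (fun R => PartialElementary L (R ∪ diag A) ∧ ∀ t ∈ R, t.2 ∈ X) (fun m => {t | t.1 = h m})
    (fun R R' hRR' hR => ⟨hR.1.mono (union_subset_union_left _ hRR'), fun t ht => hR.2 t (hRR' ht)⟩)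
    (by
      intro R hR
      refine ⟨partialElementary_of_finite fun F hF hFf => ?_, fun t ht =>
        (hR {t} (by simpa using ht) (finite_singleton t)).2 t rfl⟩
      refine (hR (F ∩ R) inter_subset_right (hFf.subset inter_subset_left)).1.mono fun t ht => ?_
      exact (hF ht).imp (fun h => ⟨ht, h⟩) id)
    ⟨by rw [empty_union]; exact partialElementary_diag A, by simp⟩
    (by
      intro R hR ⟨hRp, hRX⟩ m
      have hsmall : #(R ∪ diag A : Set (M × M)) < #M :=
        (mk_union_le _ _).trans_lt (add_lt_of_lt hinf hR (mk_image_le.trans_lt hA))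
      obtain ⟨d, hd⟩ := hsat.exists_insert hRp hsmall (h m)
      by_cases hm : ∃ g, (h m, g) ∈ R
      · obtain ⟨g, hg⟩ := hm
        exact ⟨_, rfl, by rw [insert_eq_of_mem hg]; exact ⟨hRp, hRX⟩⟩
      obtain ⟨b, hbX, hb⟩ := hX (Prod.snd '' (R ∪ diag A)) d (mk_image_le.trans_lt hsmall) (by
          rintro ⟨t, ht, htd⟩
          have : t.1 = h m := (hd.eq_iff (Or.inr ht) (Or.inl rfl)).2 htd
          rcases ht with ht | ⟨a, ha, rfl⟩
          · exact hm ⟨t.2, by rwa [← this]⟩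
          · exact (hh' m).notMem hc (by rwa [← this]))
        (fun a ha => ⟨(a, a), Or.inr ⟨a, ha, rfl⟩, rfl⟩)
        ((hh' m).trans (PartialElementary.mono hd (insert_subset_insert subset_union_right)))
      refine ⟨(h m, b), rfl, ?_, ?_⟩
      · rw [insert_union]
        exact hd.insert_trans subset_rfl hb
      · rintro t (rfl | ht)
        exacts [hbX, hRX t ht])
  have htD' : ∀ m, (t m).1 = h m := htD
  refine ⟨((hqe.partialElementary_graph h).trans ht (Q := range fun m => (m, (t m).2))
    ?_).embedding (fun m => (t m).2) fun m => ⟨m, rfl⟩, fun m => htX _ ⟨m, rfl⟩⟩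
  rintro _ ⟨m, rfl⟩
  exact ⟨h m, ⟨m, rfl⟩, Or.inl ⟨m, by rw [← htD' m]⟩⟩

/-- Under strong universal duplication, one of fewer than `|M|` sets that cover `M` contains a copy
of `M`. -/
theorem exists_containsCopy_of_cover (hreg : (#M).IsRegular) (hsat : IsSaturated L M #M)
    (hqe : HasQuantifierElimination L M) (hdup : StrongUniversalDuplication L M) {I : Type w}
    (hI : #I < #M) (X : I → Set M) (hX : ∀ m, ∃ i, m ∈ X i) : ∃ i, ContainsCopy L (X i) := by
  by_contra! hno
  rw [strongUniversalDuplication_iff hqe] at hdup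
  have hM : Nonempty M := mk_ne_zero_iff.1 hreg.ne_zero
  -- A pair `(A, c)` stands for the type of `c` over `A`, and `le` is extension of types.
  let le : Set M × M → Set M × M → Prop := fun s t => s.1 ⊆ t.1 ∧ SameTypeOver L s.1 s.2 t.2
  -- A finite subchain is realized by the point of its largest member; regularity keeps the union of
  -- the parameter sets small enough for saturation.
  have bound : ∀ R : Set (Set M × M), #R < #M → (∀ s ∈ R, #s.1 < #M ∧ s.2 ∉ s.1) →
      (∀ s ∈ R, ∀ t ∈ R, le s t ∨ le t s) → ∃ c, ∀ s ∈ R, SameTypeOver L s.1 s.2 c := by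
    intro R hR hR' hchain
    suffices h : ∃ c, ∀ s : R, SameTypeOver L s.1.1 s.1.2 c from
      h.imp fun c hc s hs => hc ⟨s, hs⟩
    refine hsat.exists_forall (J := R) (fun s => diag s.1.1) (fun s => s.1.2) ?_ ?_
    · refine (card_iUnion_lt_iff_forall_of_isRegular hreg hR).2 fun s => ?_
      exact mk_image_le.trans_lt (mk_image_le.trans_lt (hR' _ s.2).1)
    · intro s hs
      have : s = ∅ ∨ ∃ m ∈ s, ∀ j ∈ s, le j m := by
        induction s, hs using Set.Finite.induction_on with
        | empty => exact Or.inl rfl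
        | @insert a s _ _ ih =>
          right
          rcases ih with rfl | ⟨m, hm, hle⟩
          · exact ⟨a, by simp, by simpa using ⟨subset_rfl, SameTypeOver.refl _ _⟩⟩
          rcases hchain a a.2 m m.2 with h | h
          · exact ⟨m, Or.inr hm, forall_mem_insert.2 ⟨h, hle⟩⟩
          · refine ⟨a, Or.inl rfl, ?_⟩
            rintro j (rfl | hj)
            · exact ⟨subset_rfl, SameTypeOver.refl _ _⟩
            · exact ⟨(hle j hj).1.trans h.1, (hle j hj).2.trans (h.2.mono (hle j hj).1)⟩
      rcases this with rfl | ⟨m, -, hm⟩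
      · exact ⟨hM.some, by simp⟩
      · exact ⟨m.1.2, fun j hj => (hm j hj).2⟩
  -- If no extension is omitted by `X i`, then `containsCopy_of_forall_exists` puts a copy of `M`
  -- into `X i`.
  have next : ∀ (i : I) (A : Set M) (c : M), #A < #M → c ∉ A → ∃ t : Set M × M,
      #t.1 < #M ∧ t.2 ∉ t.1 ∧ le (A, c) t ∧ ∀ b, SameTypeOver L t.1 t.2 b → b ∉ X i := by
    intro i A c hA hc
    by_contra! hcon
    obtain ⟨h, hh⟩ := hdup A c hA hc
    refine hno i (containsCopy_of_forall_exists hqe hsat hreg.aleph0_le hA hc hh ?_)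
    intro B d hB hd hAB hcd
    obtain ⟨b, hb, hbX⟩ := hcon (B, d) hB hd ⟨hAB, hcd⟩
    exact ⟨b, hbX, hb⟩
  obtain ⟨t, ⟨ht, htc⟩, htD⟩ := exists_meets_of_finite_character (T := Set M × M) hI.le
    (fun R => (∀ s ∈ R, #s.1 < #M ∧ s.2 ∉ s.1) ∧ ∀ s ∈ R, ∀ t ∈ R, le s t ∨ le t s)
    (fun i => {t | ∀ b, SameTypeOver L t.1 t.2 b → b ∉ X i})
    (fun R R' hRR' hR => ⟨fun s hs => hR.1 s (hRR' hs), fun s hs t ht =>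
      hR.2 s (hRR' hs) t (hRR' ht)⟩)
    (fun R hR => ⟨fun s hs => (hR {s} (by simpa using hs) (finite_singleton s)).1 s rfl,
      fun s hs t ht => (hR {s, t} (by simp [insert_subset_iff, hs, ht]) (by simp)).2 s (by simp) t
        (by simp)⟩)
    (by simp)
    (by
      intro R hR ⟨hR', hchain⟩ i
      obtain ⟨c, hc⟩ := bound R hR hR' hchain
      obtain ⟨t, ht, ht', htle, htX⟩ := next i (⋃ s ∈ R, s.1) c
        (by
          refine (card_biUnion_lt_iff_forall_of_isRegular hreg hR).2 fun s hs => (hR' s hs).1)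
        (by
          simp only [mem_iUnion, not_exists]
          exact fun s hs => (hc s hs).notMem (hR' s hs).2)
      have hle : ∀ s ∈ R, le s t := fun s hs =>
        ⟨(subset_biUnion_of_mem (u := fun s : Set M × M => s.1) hs).trans htle.1,
          (hc s hs).trans (htle.2.mono (subset_biUnion_of_mem (u := fun s : Set M × M => s.1) hs))⟩
      refine ⟨t, htX, ?_, ?_⟩
      · rintro s (rfl | hs)
        exacts [⟨ht, ht'⟩, hR' s hs]
      · rintro s (rfl | hs) s' (rfl | hs')
        · exact Or.inl ⟨subset_rfl, SameTypeOver.refl _ _⟩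
        · exact Or.inr (hle _ hs')
        · exact Or.inl (hle _ hs)
        · exact hchain s hs s' hs')
  obtain ⟨c, hc⟩ := bound (range t) (mk_range_le.trans_lt hI) ht htc
  obtain ⟨i, hi⟩ := hX c
  exact htD i c (hc _ ⟨i, rfl⟩) hi

end Duplication

/-! ### From indivisibility to sunflowers -/

section Sunflower

variable {L : FirstOrder.Language.{u, v}} {M : Type w} [L.Structure M]

theorem ContainsCopy.of_preimage {h : M ↪[L] M} {X : Set M} (hX : ContainsCopy L (h ⁻¹' X)) :
    ContainsCopy L X := by
  obtain ⟨g, hg⟩ := hX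
  exact ⟨h.comp g, hg⟩

/-- If no point belongs to all the sets that label a copy of `M`, then there is a copy of `M` that
is labelled by pairwise disjoint sets. -/
theorem exists_embedding_pairwise_disjoint (hreg : (#M).IsRegular) (hsat : IsSaturated L M #M)
    (hqe : HasQuantifierElimination L M) (hdup : StrongUniversalDuplication L M) {α : Type x}
    {n : ℕ} (f : M → Finset α) (hf : ∀ m, (f m).card = n)
    (hno : ∀ e, ¬ ContainsCopy L {m | e ∈ f m}) :
    ∃ g : M ↪[L] M, ∀ m m', m ≠ m' → Disjoint (f (g m)) (f (g m')) := by
  have hdup' := (strongUniversalDuplication_iff hqe).1 hdup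
  obtain ⟨t, ⟨ht, htf⟩, htD⟩ := exists_meets_of_finite_character (T := M × M) (I := M) le_rfl
    (fun R => PartialElementary L R ∧ ∀ s ∈ R, ∀ t ∈ R, s ≠ t → Disjoint (f s.2) (f t.2))
    (fun m => {t | t.1 = m})
    (fun R R' hRR' hR => ⟨hR.1.mono hRR', fun s hs t ht => hR.2 s (hRR' hs) t (hRR' ht)⟩)
    (fun R hR => ⟨partialElementary_of_finite fun F hF hFf => (hR F hF hFf).1,
      fun s hs t ht => (hR {s, t} (by simp [insert_subset_iff, hs, ht]) (by simp)).2 s (by simp) t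
        (by simp)⟩)
    ⟨partialElementary_empty, by simp⟩
    (by
      intro R hR ⟨hRp, hRf⟩ m
      by_cases hm : ∃ g, (m, g) ∈ R
      · obtain ⟨g, hg⟩ := hm
        exact ⟨_, rfl, by rw [insert_eq_of_mem hg]; exact ⟨hRp, hRf⟩⟩
      obtain ⟨d, hd⟩ := hsat.exists_insert hRp hR m
      have hdR : d ∉ Prod.snd '' R := by
        rintro ⟨t, ht, htd⟩
        have : t.1 = m := (hd.eq_iff (Or.inr ht) (Or.inl rfl)).2 htd
        exact hm ⟨t.2, by rwa [← this]⟩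
      obtain ⟨h, hh⟩ := hdup' _ d (mk_image_le.trans_lt hR) hdR
      obtain ⟨b, hb, hbf⟩ : ∃ b, SameTypeOver L (Prod.snd '' R) d b ∧
          ∀ t ∈ R, Disjoint (f b) (f t.2) := by
        by_contra! hcon
        -- The index `(t, i)` names the `i`-th element of the label of `t.2`. This keeps the index
        -- type in the universe of `M`, whatever that of `α`.
        have hI : #(R × Fin n) < #M := by
          rw [mk_prod, lift_uzero]
          exact mul_lt_of_lt hreg.aleph0_le hR
            ((lift_lt_aleph0.2 (lt_aleph0_of_finite _)).trans_le hreg.aleph0_le)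
        obtain ⟨i, hi⟩ := exists_containsCopy_of_cover hreg hsat hqe hdup hI
          (fun i => h ⁻¹' {m | (((f i.1.1.2).equivFinOfCardEq (hf _)).symm i.2 : α) ∈ f m})
          (by
            intro k
            obtain ⟨t, ht, htk⟩ := hcon (h k) (hh.subset ⟨k, rfl⟩)
            obtain ⟨e, he, he'⟩ := Finset.not_disjoint_iff.1 htk
            exact ⟨⟨⟨t, ht⟩, (f t.2).equivFinOfCardEq (hf _) ⟨e, he'⟩⟩, by simpa using he⟩)
        exact hno _ hi.of_preimage
      refine ⟨(m, b), rfl, hd.insert_trans subset_rfl hb, ?_⟩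
      rintro s (rfl | hs) t (rfl | ht) hst
      · exact (hst rfl).elim
      · exact hbf t ht
      · exact (hbf s hs).symm
      · exact hRf s hs t ht hst)
  have htD' : ∀ m, (t m).1 = m := htD
  refine ⟨ht.embedding (fun m => (t m).2) fun m => ⟨m, Prod.ext (htD m) rfl⟩, fun m m' hmm' =>
    htf _ ⟨m, rfl⟩ _ ⟨m', rfl⟩ fun h => hmm' ?_⟩
  rw [← htD' m, ← htD' m', h]

/-- Under strong universal duplication, some copy of `M` is labelled by a sunflower. -/
theorem exists_embedding_inter_eq (hreg : (#M).IsRegular) (hsat : IsSaturated L M #M)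
    (hqe : HasQuantifierElimination L M) (hdup : StrongUniversalDuplication L M) {α : Type x}
    (n : ℕ) (f : M → Finset α) (hf : ∀ m, (f m).card = n) :
    ∃ (g : M ↪[L] M) (r : Set α), ∀ m m', m ≠ m' → (f (g m) : Set α) ∩ f (g m') = r := by
  classical
  by_cases hno : ∀ e, ¬ ContainsCopy L {m | e ∈ f m}
  · obtain ⟨g, hg⟩ := exists_embedding_pairwise_disjoint hreg hsat hqe hdup f hf hno
    exact ⟨g, ∅, fun m m' hm => disjoint_iff_inter_eq_empty.1
      (Finset.disjoint_coe.2 (hg m m' hm))⟩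
  · push Not at hno
    obtain ⟨e, h, he⟩ := hno
    have he' : ∀ m, e ∈ f (h m) := he
    cases n with
    | zero => simpa [Finset.card_eq_zero.1 (hf _)] using he' (mk_ne_zero_iff.1 hreg.ne_zero).some
    | succ n =>
      obtain ⟨g, r, hg⟩ := exists_embedding_inter_eq hreg hsat hqe hdup n
        (fun m => (f (h m)).erase e) fun m => by rw [Finset.card_erase_of_mem (he m), hf]; rfl
      refine ⟨h.comp g, insert e r, fun m m' hm => ?_⟩
      rw [← hg m m' hm, Finset.coe_erase, Finset.coe_erase]
      ext y
      by_cases hy : y = e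
      · simp [hy, he']
      · simp [hy]

theorem StrongUniversalDuplication.sunflowerable (hreg : (#M).IsRegular)
    (hsat : IsSaturated L M #M) (hqe : HasQuantifierElimination L M)
    (hdup : StrongUniversalDuplication L M) : Sunflowerable.{u, v, w, x} L M := by
  rintro n α Y _ ⟨e⟩ hY
  obtain ⟨g, r, hg⟩ := exists_embedding_inter_eq hreg hsat hqe hdup n
    (fun m => (e.symm m : Finset α)) fun m => hY _ (e.symm m).2
  let k : Y ↪[L] Y := e.symm.toEmbedding.comp (g.comp e.toEmbedding)
  refine ⟨k.toHom.range, ⟨k.equivRange.symm⟩, r, ?_⟩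
  rintro _ ⟨_, ⟨y, rfl⟩, rfl⟩ _ ⟨_, ⟨y', rfl⟩, rfl⟩ hne
  exact hg (e y) (e y') fun h => hne (by rw [e.injective h])

end Sunflower

/-! ### Strong universal duplication from 3-amalgamation -/

section Amalgamation

variable {L : FirstOrder.Language.{u, v}} {M : Type w} [L.Structure M]

theorem SameType.partialElementary_range {ι : Type*} {a b : ι → M} (h : SameType L a b) :
    PartialElementary L (range fun i => (a i, b i)) :=
  h.partialElementary fun _ => id

theorem sameTypeOver_of_finite {A : Set M} {c d : M}
    (h : ∀ F ⊆ A, F.Finite → SameTypeOver L F c d) : SameTypeOver L A c d := by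
  refine partialElementary_of_finite fun F hF hFf => ?_
  refine PartialElementary.mono (h (A ∩ Prod.fst '' F) inter_subset_left
    ((hFf.image _).subset inter_subset_right)) fun t ht => ?_
  rcases hF ht with rfl | ⟨a, ha, rfl⟩
  · exact Or.inl rfl
  · exact Or.inr ⟨a, ⟨ha, _, ht, rfl⟩, rfl⟩

theorem UniqueUnaryQFType.sameType (hqe : HasQuantifierElimination L M)
    (huniq : UniqueUnaryQFType L M) (c d : M) {ι : Type*} :
    SameType L (fun _ : ι => c) (fun _ : ι => d) :=
  (hqe.qfType_eq_iff.1 (huniq c d)).comp fun _ => ()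

theorem ThreeAmalgamation.exists_sameTypeOver_of_finite (hsat : IsSaturated L M #M)
    (hinf : ℵ₀ ≤ #M) (hqe : HasQuantifierElimination L M) (huniq : UniqueUnaryQFType L M)
    (ham : ThreeAmalgamation L M) {A B : Set M} (hA : A.Finite) (hB : B.Finite)
    (hAB : Disjoint A B) {c d : M} (hc : c ∉ A) (hd : d ∉ B) :
    ∃ e, SameTypeOver L A c e ∧ SameTypeOver L B d e := by
  have enum : ∀ S : Set M, S.Finite → ∃ (k : ℕ) (a : Fin k → M), range a = S := fun S hS => by
    lift S to Finset M using hS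
    exact ⟨S.card, fun i => S.equivFin.symm i, by
      rw [← Function.comp_def, EquivLike.range_comp Subtype.val]; exact Subtype.range_coe⟩
  obtain ⟨k, a, rfl⟩ := enum A hA
  obtain ⟨l, b, rfl⟩ := enum B hB
  -- The third tuple is a single point, so the restrictions to it agree by the unique unary type.
  -- Since `x y` and `a b` have the same type, saturation then carries `z 0` to a point `e` over `a
  -- b`.
  obtain ⟨x, y, z, hxy, hyz, hzx⟩ := ham k l 1 a a b b (fun _ => d) (fun _ => c) hAB
    (by simpa using hd) (by simpa using hc) rfl rfl (hqe.qfType_eq_iff.2 (huniq.sameType hqe d c))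
  rw [hqe.qfType_eq_iff] at hxy hyz hzx
  obtain ⟨e, he⟩ := hsat.exists_insert hxy.partialElementary_range
    ((lt_aleph0_iff_set_finite.2 (finite_range _)).trans_le hinf) (z 0)
  refine ⟨e, hzx.symm.partialElementary_range.trans he ?_,
    hyz.symm.partialElementary_range.trans he ?_⟩
  · rintro _ (rfl | ⟨_, ⟨i, rfl⟩, rfl⟩)
    · exact ⟨z 0, ⟨Sum.inl 0, rfl⟩, Or.inl rfl⟩
    · exact ⟨x i, ⟨Sum.inr i, rfl⟩, Or.inr ⟨Sum.inl i, rfl⟩⟩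
  · rintro _ (rfl | ⟨_, ⟨i, rfl⟩, rfl⟩)
    · exact ⟨z 0, ⟨Sum.inr 0, rfl⟩, Or.inl rfl⟩
    · exact ⟨y i, ⟨Sum.inl i, rfl⟩, Or.inr ⟨Sum.inr i, rfl⟩⟩

/-- Types over disjoint small sets have a common realization. -/
theorem ThreeAmalgamation.exists_sameTypeOver (hsat : IsSaturated L M #M)
    (hinf : ℵ₀ ≤ #M) (hqe : HasQuantifierElimination L M) (huniq : UniqueUnaryQFType L M)
    (ham : ThreeAmalgamation L M) {A B : Set M} (hA : #A < #M) (hB : #B < #M)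
    (hAB : Disjoint A B) {c d : M} (hc : c ∉ A) (hd : d ∉ B) :
    ∃ e, SameTypeOver L A c e ∧ SameTypeOver L B d e := by
  -- The restrictions of the two types to finite parameter sets.
  let J := {j : Set M × M // j.1.Finite ∧ (j.1 ⊆ A ∧ j.2 = c ∨ j.1 ⊆ B ∧ j.2 = d)}
  obtain ⟨e, he⟩ : ∃ e, ∀ j : J, SameTypeOver L j.1.1 j.1.2 e := by
    refine hsat.exists_forall (J := J) (fun j => diag j.1.1) (fun j => j.1.2) ?_ fun s hs => ?_
    · refine (mk_le_mk_of_subset (t := A ∪ B) ?_).trans_lt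
        ((mk_union_le _ _).trans_lt (add_lt_of_lt hinf hA hB))
      refine iUnion_subset ?_
      rintro j _ ⟨_, ⟨a, ha, rfl⟩, rfl⟩
      exact j.2.2.imp (fun h => h.1 ha) (fun h => h.1 ha)
    · have hU : (⋃ j ∈ s, j.1.1).Finite := hs.biUnion fun j _ => j.2.1
      obtain ⟨e, hce, hde⟩ := ham.exists_sameTypeOver_of_finite hsat hinf hqe huniq
        (hU.subset (inter_subset_right (s := A))) (hU.subset (inter_subset_right (s := B)))
        (hAB.mono inter_subset_left inter_subset_left) (fun h => hc h.1) (fun h => hd h.1)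
      refine ⟨e, fun j hj => ?_⟩
      have hj' : j.1.1 ⊆ ⋃ j ∈ s, j.1.1 := subset_biUnion_of_mem (u := fun j : J => j.1.1) hj
      rcases j.2.2 with ⟨h, h'⟩ | ⟨h, h'⟩
      · rw [h']
        exact hce.mono (subset_inter h hj')
      · rw [h']
        exact hde.mono (subset_inter h hj')
  exact ⟨e, sameTypeOver_of_finite fun F hF hFf => he ⟨(F, c), hFf, Or.inl ⟨hF, rfl⟩⟩,
    sameTypeOver_of_finite fun F hF hFf => he ⟨(F, d), hFf, Or.inr ⟨hF, rfl⟩⟩⟩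

theorem ThreeAmalgamation.strongUniversalDuplication (hsat : IsSaturated L M #M)
    (hinf : ℵ₀ ≤ #M) (hqe : HasQuantifierElimination L M) (huniq : UniqueUnaryQFType L M)
    (ham : ThreeAmalgamation L M) : StrongUniversalDuplication L M := by
  rw [strongUniversalDuplication_iff hqe]
  intro A c hA hc
  let N : Set M := {b | SameTypeOver L A c b}
  have hNA : Disjoint A N := disjoint_right.2 fun b (hb : SameTypeOver L A c b) => hb.notMem hc
  -- Back-and-forth between `M` and `N`, with one task per element of `M ⊕ N`. Going forth
  -- amalgamates the required type over the images with that of `c` over `A`; the images lie in `N`,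
  -- hence off `A`. Going back needs only saturation.
  obtain ⟨t, ⟨ht, htN⟩, htD⟩ := exists_meets_of_finite_character (T := M × M) (I := M ⊕ N)
    (κ := #M) (by
      rw [mk_sum, lift_id, lift_id, add_eq_left hinf (mk_set_le _)])
    (fun R => PartialElementary L R ∧ ∀ t ∈ R, t.2 ∈ N)
    (Sum.elim (fun m => {t | t.1 = m}) (fun n => {t | t.2 = n}))
    (fun R R' hRR' hR => ⟨hR.1.mono hRR', fun s hs => hR.2 s (hRR' hs)⟩)
    (fun R hR => ⟨partialElementary_of_finite fun F hF hFf => (hR F hF hFf).1,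
      fun s hs => (hR {s} (by simpa using hs) (finite_singleton s)).2 s rfl⟩)
    ⟨partialElementary_empty, by simp⟩
    (by
      rintro R hR ⟨hRp, hRN⟩ (m | n)
      · by_cases hm : ∃ g, (m, g) ∈ R
        · obtain ⟨g, hg⟩ := hm
          exact ⟨_, rfl, by rw [insert_eq_of_mem hg]; exact ⟨hRp, hRN⟩⟩
        obtain ⟨d, hd⟩ := hsat.exists_insert hRp hR m
        have hdR : d ∉ Prod.snd '' R := by
          rintro ⟨t, ht, htd⟩
          have : t.1 = m := (hd.eq_iff (Or.inr ht) (Or.inl rfl)).2 htd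
          exact hm ⟨t.2, by rwa [← this]⟩
        obtain ⟨e, hce, hde⟩ := ham.exists_sameTypeOver hsat hinf hqe huniq hA
          (mk_image_le.trans_lt hR) (hNA.mono_right (by rintro _ ⟨t, ht, rfl⟩; exact hRN t ht))
          hc hdR
        exact ⟨(m, e), rfl, hd.insert_trans subset_rfl hde, forall_mem_insert.2 ⟨hce, hRN⟩⟩
      · obtain ⟨m, hm⟩ := hsat.exists_insert hRp.swap (mk_image_le.trans_lt hR) n
        refine ⟨(m, n), rfl, hm.swap.mono ?_, forall_mem_insert.2 ⟨n.2, hRN⟩⟩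
        rw [image_insert_eq, image_image]
        simp)
  have hD : ∀ m, (t (Sum.inl m)).1 = m := fun m => htD (Sum.inl m)
  have hD' : ∀ n : N, (t (Sum.inr n)).2 = n := fun n => htD (Sum.inr n)
  have hg : ∀ m, (m, (t (Sum.inl m)).2) ∈ range t := fun m =>
    ⟨Sum.inl m, Prod.ext (hD m) rfl⟩
  refine ⟨ht.embedding (fun m => (t (Sum.inl m)).2) hg, Subset.antisymm ?_ fun n hn => ?_⟩
  · rintro _ ⟨m, rfl⟩
    exact htN _ ⟨Sum.inl m, rfl⟩
  · refine ⟨(t (Sum.inr ⟨n, hn⟩)).1, ?_⟩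
    exact ((ht.eq_iff (hg _) ⟨Sum.inr ⟨n, hn⟩, rfl⟩).1 rfl).trans (hD' ⟨n, hn⟩)

end Amalgamation

/-! ### 3-amalgamation of types from 3-disjoint amalgamation of the age -/

section Age

variable {L : FirstOrder.Language.{u, v}} {M : Type w} [L.Structure M]

theorem SameType.exists_map {ι : Type*} {a a' : ι → M} (h : SameType L a a') :
    ∃ α : M → M, InjOn α (range a) ∧ ∀ i, α (a i) = a' i := by
  have hα : ∀ i, Function.extend a a' id (a i) = a' i :=
    Function.FactorsThrough.extend_apply (fun i j hij => (h.eq_iff i j).1 hij) id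
  refine ⟨Function.extend a a' id, ?_, hα⟩
  rintro _ ⟨i, rfl⟩ _ ⟨j, rfl⟩ hij
  rw [hα, hα] at hij
  exact (h.eq_iff i j).2 hij

theorem SameType.relMap_iff {n : ℕ} {a b : Fin n → M} (h : SameType L a b) (R : L.Relations n) :
    Language.Structure.RelMap R a ↔ Language.Structure.RelMap R b := by
  simpa [Language.Formula.realize_rel] using
    h (Language.Relations.formula R fun i => Language.Term.var i)

/-- The structure on `A` that is pulled back from `M` along a function. -/
abbrev inducedStructure [L.IsRelational] {A : Type*} (φ : A → M) : L.Structure A where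
  funMap f := isEmptyElim f
  RelMap R t := Language.Structure.RelMap R (φ ∘ t)

/-- Realize `p`, `q`, `r` by finite structures on the pairwise unions of three disjoint blocks of
points, one for each of `x`, `y`, `z`. The equal restrictions say that these structures agree on the
shared blocks; an amalgam embedded in `M` realizes all three types. -/
theorem age_threeAmalgamation [L.IsRelational] (hqe : HasQuantifierElimination L M)
    (ham : DisjointAmalgamationProperty L 3 (L.age M)) : ThreeAmalgamation L M := by
  intro k l m a a' b b' c c' hab hbc hca haa' hbb' hcc'
  rw [hqe.qfType_eq_iff] at haa' hbb' hcc'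
  obtain ⟨α, hα, hαa⟩ := haa'.exists_map
  obtain ⟨β, hβ, hβb⟩ := hbb'.exists_map
  obtain ⟨γ, hγ, hγc⟩ := hcc'.exists_map
  -- The tags keep the three tuples apart, even where `a` and `c` share points. The maps `φ i` read
  -- the blocks back in `M` as `(a, b)`, `(b', c)` and `(c', a')`; disjointness within each pair
  -- makes them injective on `A i`.
  let U : Fin k → M ⊕ M ⊕ M := fun i => Sum.inl (a i)
  let V : Fin l → M ⊕ M ⊕ M := fun i => Sum.inr (Sum.inl (b i))
  let W : Fin m → M ⊕ M ⊕ M := fun i => Sum.inr (Sum.inr (c i))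
  let A : Fin 3 → Set (M ⊕ M ⊕ M) :=
    ![range U ∪ range V, range V ∪ range W, range W ∪ range U]
  let φ : Fin 3 → M ⊕ M ⊕ M → M :=
    ![Sum.elim id (Sum.elim id id), Sum.elim id (Sum.elim β id), Sum.elim α (Sum.elim id γ)]
  have hφ : ∀ i, InjOn (φ i) (A i) := by
    rw [disjoint_range_iff] at hab hbc hca
    intro i
    fin_cases i
    · rintro _ (⟨i, rfl⟩ | ⟨i, rfl⟩) _ (⟨j, rfl⟩ | ⟨j, rfl⟩) h
      · exact congrArg Sum.inl h
      · exact (hab i j h).elim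
      · exact (hab j i h.symm).elim
      · exact congrArg (Sum.inr ∘ Sum.inl) h
    · rintro _ (⟨i, rfl⟩ | ⟨i, rfl⟩) _ (⟨j, rfl⟩ | ⟨j, rfl⟩) h
      · exact congrArg (Sum.inr ∘ Sum.inl) (hβ ⟨i, rfl⟩ ⟨j, rfl⟩ h)
      · exact (hbc i j ((hβb i).symm.trans h)).elim
      · exact (hbc j i ((hβb j).symm.trans h.symm)).elim
      · exact congrArg (Sum.inr ∘ Sum.inr) h
    · rintro _ (⟨i, rfl⟩ | ⟨i, rfl⟩) _ (⟨j, rfl⟩ | ⟨j, rfl⟩) h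
      · exact congrArg (Sum.inr ∘ Sum.inr) (hγ ⟨i, rfl⟩ ⟨j, rfl⟩ h)
      · exact (hca i j ((hγc i).symm.trans (h.trans (hαa j)))).elim
      · exact (hca j i ((hγc j).symm.trans (h.symm.trans (hαa i)))).elim
      · exact congrArg Sum.inl (hα ⟨i, rfl⟩ ⟨j, rfl⟩ h)
  have h01 : ∀ x ∈ A 0, x ∈ A 1 → (φ 0 x, φ 1 x) ∈ range fun i => (b i, b' i) := by
    rintro _ (⟨i, rfl⟩ | ⟨i, rfl⟩) (⟨j, hj⟩ | ⟨j, hj⟩)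
    · simp [U, V] at hj
    · simp [U, W] at hj
    · exact ⟨i, Prod.ext rfl (hβb i).symm⟩
    · simp [V, W] at hj
  have h02 : ∀ x ∈ A 0, x ∈ A 2 → (φ 0 x, φ 2 x) ∈ range fun i => (a i, a' i) := by
    rintro _ (⟨i, rfl⟩ | ⟨i, rfl⟩) (⟨j, hj⟩ | ⟨j, hj⟩)
    · simp [U, W] at hj
    · exact ⟨i, Prod.ext rfl (hαa i).symm⟩
    · simp [V, W] at hj
    · simp [U, V] at hj
  have h12 : ∀ x ∈ A 1, x ∈ A 2 → (φ 1 x, φ 2 x) ∈ range fun i => (c i, c' i) := by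
    rintro _ (⟨i, rfl⟩ | ⟨i, rfl⟩) (⟨j, hj⟩ | ⟨j, hj⟩)
    · simp [V, W] at hj
    · simp [U, V] at hj
    · exact ⟨i, Prod.ext rfl (hγc i).symm⟩
    · simp [U, W] at hj
  have hSame : ∀ (i j : Fin 3) (n : ℕ) (t : Fin n → M ⊕ M ⊕ M), (∀ s, t s ∈ A i) →
      (∀ s, t s ∈ A j) → SameType L (φ i ∘ t) (φ j ∘ t) := by
    intro i j n t hi hj
    fin_cases i <;> fin_cases j
    · exact fun _ => Iff.rfl
    · exact hbb'.partialElementary_range.sameType fun s => h01 _ (hi s) (hj s)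
    · exact haa'.partialElementary_range.sameType fun s => h02 _ (hi s) (hj s)
    · exact (hbb'.partialElementary_range.sameType fun s => h01 _ (hj s) (hi s)).symm
    · exact fun _ => Iff.rfl
    · exact hcc'.partialElementary_range.sameType fun s => h12 _ (hi s) (hj s)
    · exact (haa'.partialElementary_range.sameType fun s => h02 _ (hj s) (hi s)).symm
    · exact (hcc'.partialElementary_range.sameType fun s => h12 _ (hj s) (hi s)).symm
    · exact fun _ => Iff.rfl
  let S : ∀ i, L.Structure (A i) := fun i => inducedStructure fun x : A i => φ i x
  let g : ∀ i, A i ↪[L] M := fun i =>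
    { toFun := fun x => φ i x
      inj' := fun x y h => Subtype.ext (hφ i x.2 y.2 h)
      map_fun' := fun f => isEmptyElim f
      map_rel' := fun _ _ => Iff.rfl }
  have hfin : ∀ i, (A i).Finite := by
    intro i
    fin_cases i <;> exact (finite_range _).union (finite_range _)
  obtain ⟨B, ⟨-, ⟨ε⟩⟩, f, hf⟩ := ham (M ⊕ M ⊕ M) A S
    (fun i => by
      have : Finite (A i) := hfin i
      exact ⟨Language.Structure.FG.of_finite, ⟨g i⟩⟩)
    (fun i j n R t hi hj => (hSame i j n t hi hj).relMap_iff R)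
  have hq : ∀ (i : Fin 3) {ι : Type} (s : ι → A i),
      qfType L (fun p => ε (f i (s p))) = qfType L (fun p => φ i (s p)) := fun i ι s =>
    (qfType_embedding_comp (ε.comp (f i)) s).trans (qfType_embedding_comp (g i) s).symm
  have hU0 : ∀ i, U i ∈ A 0 := fun i => Or.inl ⟨i, rfl⟩
  have hV0 : ∀ i, V i ∈ A 0 := fun i => Or.inr ⟨i, rfl⟩
  have hV1 : ∀ i, V i ∈ A 1 := fun i => Or.inl ⟨i, rfl⟩
  have hW1 : ∀ i, W i ∈ A 1 := fun i => Or.inr ⟨i, rfl⟩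
  have hW2 : ∀ i, W i ∈ A 2 := fun i => Or.inl ⟨i, rfl⟩
  have hU2 : ∀ i, U i ∈ A 2 := fun i => Or.inr ⟨i, rfl⟩
  refine ⟨fun i => ε (f 0 ⟨U i, hU0 i⟩), fun i => ε (f 0 ⟨V i, hV0 i⟩),
    fun i => ε (f 1 ⟨W i, hW1 i⟩), ?_, ?_, ?_⟩
  · convert hq 0 (Sum.elim (fun i => ⟨U i, hU0 i⟩) (fun i => ⟨V i, hV0 i⟩)) using 2
    · ext (i | i) <;> rfl
    · ext (i | i) <;> rfl
  · convert hq 1 (Sum.elim (fun i => ⟨V i, hV1 i⟩) (fun i => ⟨W i, hW1 i⟩)) using 2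
    · ext (i | i)
      · exact congrArg ε ((hf 0 1 _ _).2 rfl)
      · rfl
    · ext (i | i)
      · exact (hβb i).symm
      · rfl
  · convert hq 2 (Sum.elim (fun i => ⟨W i, hW2 i⟩) (fun i => ⟨U i, hU2 i⟩)) using 2
    · ext (i | i)
      · exact congrArg ε ((hf 1 2 _ _).2 rfl)
      · exact congrArg ε ((hf 0 2 _ _).2 rfl)
    · ext (i | i)
      · exact (hγc i).symm
      · exact (hαa i).symm

end Age

end StructuredSunflower

theorem mainTheorem2 (L : FirstOrder.Language.{u, v}) (M : Type w) [L.Structure M]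
    (hreg : (Cardinal.mk M).IsRegular)
    (hsat : StructuredSunflower.IsSaturated L M (Cardinal.mk M))
    (hqe : StructuredSunflower.HasQuantifierElimination L M) :
    (StructuredSunflower.StrongUniversalDuplication L M →
      StructuredSunflower.Sunflowerable.{u, v, w, x} L M) ∧
    (StructuredSunflower.UniqueUnaryQFType L M → StructuredSunflower.ThreeAmalgamation L M →
      StructuredSunflower.StrongUniversalDuplication L M ∧
      StructuredSunflower.Sunflowerable.{u, v, w, x} L M) ∧
    (∀ [L.IsRelational], StructuredSunflower.UniqueUnaryQFType L M →
      StructuredSunflower.DisjointAmalgamationProperty L 3 (L.age M) →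
      StructuredSunflower.Sunflowerable.{u, v, w, x} L M) := by
  refine ⟨fun hdup => hdup.sunflowerable hreg hsat hqe, fun huniq ham => ?_,
    fun huniq ham => ?_⟩
  · have hdup := ham.strongUniversalDuplication hsat hreg.aleph0_le hqe huniq
    exact ⟨hdup, hdup.sunflowerable hreg hsat hqe⟩
  · exact ((StructuredSunflower.age_threeAmalgamation hqe ham).strongUniversalDuplication hsat
      hreg.aleph0_le hqe huniq).sunflowerable hreg hsat hqe
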